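/- Let $\mathcal G$ be a finite $N$-player game in which all players have the same finite action set $\mathbb A$, with reward functions $r^i:\mathbb A^N\to\mathbb R$. Assume that $\mathcal G$ is - *anonymous*: for every player $i$, the reward $r^i(a^i,a^{-i})$ is unchanged when the actions $a^{-i}$ of the other players are permuted; and - *polymatrix*: for every $i$ there are functions $r^{ij}:\mathbb A\times\mathbb A\to\mathbb R$, $j\ne i$, with $r^i(a)=\sum_{j\neq i}r^{ij}(a^i,a^j)$ for all $a\in\mathbb A^N$. Assume further that $\mathcal G$ is zero-sum ($\sum_{i}r^i(a)=0$ for all $a$) or that $\mathcal G$ is an exact potential game (there is $\phi:\mathbb A^N\to\mathbb R$ such that $r^i(b,a^{-i})-r^i(a)=\phi(b,a^{-i})-\phi(a)$ for all $i$, $a\in\mathbb A^N$, $b\in\mathbb A$). For $a\in\mathbb A^N$ let $\sigma(a^{-i})=\sum_{j\ne i}\mathbf 1\{a^j\}\in\mathbb X=\{\xi\in\mathbb N^{\mathbb A}:\sum_{c}\xi_c=N-1\}$ count the players other than $i$ that play each action, where $\mathbf 1\{y\}$ is the unit vector at position $y$. Let $\bar r^i:\mathbb A\times\mathbb X\to\mathbb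 R$ be the succinct representation of $r^i$, that is, $\bar r^i(a^i,\sigma(a^{-i}))=r^i(a)$ for all $a$, and put $\bar R^i(b,\mu)=\sum_{x\in\mathbb X}\bar r^i(b,x)\,\mu(x)$ for $b\in\mathbb A$, $\mu\in\mathbb R^{\mathbb X}$. Let $(\alpha_k)_{k\ge1}$ be nonnegative step sizes with $\sum_{k}\alpha_k=\infty$ and $\sum_k\alpha_k^2<\infty$. Let $(a_k)_{k\ge0}$ be any sequence of joint actions generated by *aggregate fictitious play* (agg-FP): with the aggregate beliefs $$\hat\mu^i_0=\mathbf 1\{\sigma(a_0^{-i})\},\qquad \hat\mu^i_k=\hat\mu^i_{k-1}+\alpha_k\bigl(\mathbf 1\{\sigma(a_k^{-i})\}-\hat\mu^i_{k-1}\bigr)\quad(k\ge1),$$ every player $i$ satisfies $a^i_{k+1}\in\arg\max_{b\in\mathbb A}\bar R^i(b,\hat\mu^i_k)$ for every $k\ge1$ (arbitrary initial actions, arbitrary tie-breaking). Define the empirical action frequencies by $$\hat\gamma^i_0=\mathbf 1\{a^i_0\},\qquad \hat\gamma^i_k=\hat\gamma^i_{k-1}+\alpha_k\bigl(\mathbf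 1\{a^i_k\}-\hat\gamma^i_{k-1}\bigr)\quad(k\ge1).$$ Then agg-FP converges to Nash equilibrium: if $\mathbb{NE}(\mathcal G)$ denotes the set of mixed Nash equilibria of $\mathcal G$, then $$\lim_{k\to\infty}\ \inf_{\pi_*\in\mathbb{NE}(\mathcal G)}\|\hat\gamma_k-\pi_*\|=0 .$$ -/

import Mathlib

open Filter Topology

/-- An `N`-player matrix game in which every player has the same action set `A`:
`G.reward i a` is the reward of player `i` under the joint action `a`. -/
structure MatrixGame (N : ℕ) (A : Type*) where
  reward : Fin N → (Fin N → A) → ℝ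

namespace MatrixGame

variable {N : ℕ} {A : Type*}

/-- Polymatrix (separable network) game: rewards are sums of pairwise interactions. -/
def IsPolymatrix (G : MatrixGame N A) : Prop :=
  ∃ r : Fin N → Fin N → A → A → ℝ, ∀ (i : Fin N) (a : Fin N → A),
    G.reward i a = ∑ j ∈ Finset.univ.erase i, r i j (a i) (a j)

/-- Anonymous game: permuting the actions of the players other than `i`
(that is, applying a permutation of the players which fixes `i`) does not affect the reward
of player `i`. -/
def IsAnonymous (G : MatrixGame N A) : Prop :=
  ∀ (i : Fin N) (ρ : Equiv.Perm (Fin N)), ρ i = i → ∀ a : Fin N → A,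
    G.reward i (fun j => a (ρ j)) = G.reward i a

/-- Zero-sum game: the rewards of all players add up to zero under each joint action. -/
def IsZeroSum (G : MatrixGame N A) : Prop :=
  ∀ a : Fin N → A, ∑ i, G.reward i a = 0

/-- (Exact) potential game. -/
def IsPotential (G : MatrixGame N A) : Prop :=
  ∃ φ : (Fin N → A) → ℝ, ∀ (i : Fin N) (a : Fin N → A) (b : A),
    G.reward i (Function.update a i b) - G.reward i a = φ (Function.update a i b) - φ a

/-- Expected reward `R^i(π)` of player `i` under the strategy profile `π`. -/
def expectedReward [Fintype A] (G : MatrixGame N A) (i : Fin N) (π : Fin N → A → ℝ) : ℝ :=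
  ∑ a : Fin N → A, G.reward i a * ∏ j, π j (a j)

/-- The set of (mixed) Nash equilibria. -/
def nashEquilibria [Fintype A] (G : MatrixGame N A) : Set (Fin N → A → ℝ) :=
  {π | (∀ i, π i ∈ stdSimplex ℝ A) ∧
    ∀ (i : Fin N), ∀ p ∈ stdSimplex ℝ A,
      G.expectedReward i (Function.update π i p) ≤ G.expectedReward i π}

end MatrixGame

section Aggregation

variable {A : Type*} [Fintype A] [DecidableEq A]

/-- The finite set `𝕏` of count vectors `ξ : A → ℕ` with `∑ c, ξ c = N - 1`. It is only used in
the presence of a player `i : Fin N`, so that `N - 1` is not truncated. -/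
def countVectors (N : ℕ) (A : Type*) [Fintype A] [DecidableEq A] : Finset (A → ℕ) :=
  Finset.piAntidiag Finset.univ (N - 1)

lemma sum_single_mem_countVectors {N : ℕ} (i : Fin N) (a : Fin N → A) :
    ∑ j ∈ Finset.univ.erase i, (Pi.single (a j) 1 : A → ℕ) ∈ countVectors N A := by
  simp only [countVectors, Finset.mem_piAntidiag, Finset.mem_univ, implies_true, and_true,
    Finset.sum_apply]
  rw [Finset.sum_comm]
  simp [Pi.single_apply]

/-- The aggregate action `x^{-i} = σ(a^{-i})`: the number of players other than `i` playing each
action. -/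
def aggregate {N : ℕ} (i : Fin N) (a : Fin N → A) : countVectors N A :=
  ⟨∑ j ∈ Finset.univ.erase i, Pi.single (a j) 1, sum_single_mem_countVectors i a⟩

open Classical in
/-- The succinct representation `r̄^i : A × 𝕏 → ℝ`: the reward of player `i` at any joint action
in which `i` plays `b` and whose aggregate is `x`. Such a joint action always exists, and in an
anonymous game the value does not depend on its choice. -/
noncomputable def MatrixGame.succinctReward {N : ℕ} (G : MatrixGame N A) (i : Fin N) (b : A)
    (x : countVectors N A) : ℝ :=
  if h : ∃ a : Fin N → A, a i = b ∧ aggregate i a = x then G.reward i h.choose else 0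

/-- In an anonymous game, `r^i(a^i, a^{-i}) = r̄^i(a^i, x^{-i})`. -/
theorem MatrixGame.IsAnonymous.reward_eq_succinctReward {N : ℕ} {G : MatrixGame N A}
    (hG : G.IsAnonymous) (i : Fin N) (a : Fin N → A) :
    G.reward i a = G.succinctReward i (a i) (aggregate i a) := by
  have h : ∃ c : Fin N → A, c i = a i ∧ aggregate i c = aggregate i a := ⟨a, rfl, rfl⟩
  rw [MatrixGame.succinctReward, dif_pos h]
  obtain ⟨hc, hagg⟩ := h.choose_spec
  generalize h.choose = c at hc hagg
  have hcard : ∀ (f : Fin N → A) (b : A),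
      Fintype.card {j : {j // j ≠ i} // f j = b} = (aggregate i f : A → ℕ) b := by
    intro f b
    have h1 : (aggregate i f : A → ℕ) b =
        ∑ j : {j // j ≠ i}, (Pi.single (f j) 1 : A → ℕ) b := by
      simp only [aggregate, Finset.sum_apply]
      exact Finset.sum_subtype _ (by simp) _
    rw [h1, Fintype.card_subtype]
    simp [Pi.single_apply, eq_comm]
  have hequiv : ∀ b : A, Nonempty
      ({j : {j // j ≠ i} // a j = b} ≃ {j : {j // j ≠ i} // c j = b}) := fun b =>
    Fintype.card_eq.mp (by rw [hcard, hcard, hagg])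
  let τ : Equiv.Perm {j // j ≠ i} :=
    Equiv.ofFiberEquiv (f := fun j : {j // j ≠ i} => a j) (g := fun j : {j // j ≠ i} => c j)
      fun b => (hequiv b).some
  have hτ : ∀ j, c (τ j) = a j := fun j =>
    Equiv.ofFiberEquiv_map (f := fun j : {j // j ≠ i} => a j)
      (g := fun j : {j // j ≠ i} => c j) _ j
  have hfix : Equiv.Perm.ofSubtype τ i = i :=
    Equiv.Perm.ofSubtype_apply_of_not_mem τ (by simp)
  rw [← hG i (Equiv.Perm.ofSubtype τ) hfix c]
  congr 1
  funext j
  by_cases hj : j = i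
  · rw [hj, hfix, hc]
  · rw [Equiv.Perm.ofSubtype_apply_of_mem τ hj]
    exact (hτ ⟨j, hj⟩).symm

/-- Expected reward `R̄^i(b, μ)` of player `i` for playing `b` against the aggregate belief `μ`. -/
noncomputable def MatrixGame.aggExpectedReward {N : ℕ} (G : MatrixGame N A) (i : Fin N) (b : A)
    (μ : countVectors N A → ℝ) : ℝ :=
  ∑ x, G.succinctReward i b x * μ x

/-- The aggregate belief `μ̂^i_k` about the players other than `i`, for the history `a` of joint
actions and the step sizes `α`. -/
noncomputable def aggBelief {N : ℕ} (α : ℕ → ℝ) (a : ℕ → Fin N → A) (i : Fin N) :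
    ℕ → countVectors N A → ℝ
  | 0 => Pi.single (aggregate i (a 0)) 1
  | k + 1 => aggBelief α a i k +
      α (k + 1) • (Pi.single (aggregate i (a (k + 1))) 1 - aggBelief α a i k)

/-- The (weighted) empirical action frequencies `γ̂_k`. -/
noncomputable def empiricalFreq {N : ℕ} {A : Type*} [DecidableEq A] (α : ℕ → ℝ) (a : ℕ → Fin N → A) :
    ℕ → Fin N → A → ℝ
  | 0 => fun i => Pi.single (a 0 i) 1
  | k + 1 => fun i => empiricalFreq α a k i +
      α (k + 1) • (Pi.single (a (k + 1) i) 1 - empiricalFreq α a k i)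

/-- The sequence `a` of joint actions is generated by aggregate fictitious play: at each stage
`k ≥ 1`, every player `i` chooses `a^i_{k+1}` among the best responses to its aggregate belief
`μ̂^i_k`. The actions before that are arbitrary, and so is the rule for breaking ties. -/
def MatrixGame.IsAggFP {N : ℕ} (G : MatrixGame N A) (α : ℕ → ℝ) (a : ℕ → Fin N → A) : Prop :=
  ∀ k ≥ 1, ∀ (i : Fin N) (b : A),
    G.aggExpectedReward i b (aggBelief α a i k) ≤
      G.aggExpectedReward i (a (k + 1) i) (aggBelief α a i k)

/-- The empirical action frequencies converge to the set of Nash equilibria, i.e. their distance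
to that set tends to `0` (`Metric.infEDist` is `⊤` when the set is empty). -/
def MatrixGame.ConvergesToNash {N : ℕ} (G : MatrixGame N A) (α : ℕ → ℝ)
    (a : ℕ → Fin N → A) : Prop :=
  Tendsto (fun k => Metric.infEDist (empiricalFreq α a k) G.nashEquilibria) atTop (𝓝 0)

end Aggregation

/-- Step sizes `(α_k)_{k ≥ 1}` satisfying the Robbins-Monro conditions. -/
structure RobbinsMonro (α : ℕ → ℝ) : Prop where
  nonneg : ∀ k ≥ 1, 0 ≤ α k
  sum_eq_top : Tendsto (fun n => ∑ k ∈ Finset.Icc 1 n, α k) atTop atTop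
  sq_summable : Summable fun k => α (k + 1) ^ 2

/-! In an anonymous polymatrix game, the payoff against the aggregate belief is linear in the belief
and depends only on its marginals, so it equals the payoff against the empirical frequencies
(`MatrixGame.IsAnonymous.aggExpectedReward_aggBelief`). Aggregate fictitious play is therefore
ordinary fictitious play. Early steps may exceed one and push the frequencies out of the simplex;
restarting at a late time from a pure profile gives a process inside the simplex whose distance to
the original shrinks by `1 - α` at each step, at the price of a vanishing best response error
(`PerturbedFictitiousPlay`). It remains to show that the exploitability, the sum of the gains from
unilateral deviations, tends to zero; compactness then gives convergence to equilibria.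

Zero-sum case: the exploitability is the sum `W` of the best response values. Over a window of
length `τ` ending at time `m`, let `y` be the average of the actions played. Up to `O(τ²)`, `x m - x
k = τ (y - x m)`. If these actions are `δ`-best responses to `x m`, bilinearity and `totalPayoff r y
y = 0` yield `(1 + τ) W(x m) ≤ W(x k) + O(τ²) + O(δ)`. Continuity only gives `δ = O(τ)`, which is
too weak. But there are finitely many regrets at time `m`, so among the scales `σ ^ 2 ^ j` a
pigeonhole argument finds one with no regret between `O(τ)` and `O(τ²)`; for that window `δ =
O(τ²)`, and `W` contracts.

Potential case: each step raises the expected potential by `β k` times the exploitability, up to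
summable errors. Hence the exploitability is summable against the divergent weights `β k`, and since
it varies slowly it tends to zero. -/

/-! ### Real sequences: windows, level gaps and convergence criteria. -/

/-- Going back from a late time `t m` by roughly `s`. -/
theorem eventually_exists_window {t : ℕ → ℝ} (hmono : Monotone t) (htop : Tendsto t atTop atTop)
    (hincr : Tendsto (fun k => t (k + 1) - t k) atTop (𝓝 0)) {s : ℝ} (hs : 0 < s) (K : ℕ) :
    ∀ᶠ m in atTop, ∃ k, K ≤ k ∧ k ≤ m ∧ s / 2 ≤ t m - t k ∧ t m - t k ≤ s := by
  obtain ⟨K₁, hK₁⟩ := eventually_atTop.1 (hincr.eventually_le_const (half_pos hs))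
  filter_upwards [htop.eventually_gt_atTop (t (max K K₁) + s)] with m hm
  have hex : ∃ k, t m - t k ≤ s := ⟨m, by simpa using hs.le⟩
  classical
  -- The first time within `s` of time `m` works: its predecessor is farther than `s`, and the step
  -- between them is at most `s / 2` once the index is past `K₁`.
  have hlt : max K K₁ < Nat.find hex := by
    by_contra! h
    have := hmono h
    linarith [Nat.find_spec hex]
  obtain ⟨k, hk⟩ := Nat.exists_eq_succ_of_ne_zero (Nat.ne_of_gt (Nat.zero_lt_of_lt hlt))
  have hkK : max K K₁ ≤ k := by omega
  have h1 : ¬ t m - t k ≤ s := Nat.find_min hex (by omega)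
  have h2 : t (k + 1) - t k ≤ s / 2 := hK₁ k ((le_max_right _ _).trans hkK)
  refine ⟨Nat.find hex, (le_max_left _ _).trans hlt.le, Nat.find_min' hex (by simpa using hs.le),
    ?_, Nat.find_spec hex⟩
  rw [hk, Nat.succ_eq_add_one]
  linarith

/-- Among `card P + 1` consecutive levels, two successive ones have no value in between. -/
theorem exists_level_gap {P : Type*} [Fintype P] (f : P → ℝ) {s : ℕ → ℝ} (hs : Antitone s) :
    ∃ j ≤ Fintype.card P, ∀ p, f p ≤ s j → f p ≤ s (j + 1) := by
  by_contra! h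
  choose p hp1 hp2 using fun j : Fin (Fintype.card P + 1) => h j (Nat.lt_succ_iff.1 j.2)
  -- A value cannot fill two gaps: lying in the gap of `j` puts it above `s (j + 1)`, hence above
  -- every later level.
  have key : ∀ j l, p j = p l → ¬ j < l := by
    intro j l hjl hlt
    have h1 := hp2 j
    have h2 := hp1 l
    have h3 : s l ≤ s (j + 1) := hs (by exact_mod_cast hlt)
    rw [hjl] at h1
    linarith
  have hinj : Function.Injective p := fun j l hjl =>
    le_antisymm (not_lt.1 (key l j hjl.symm)) (not_lt.1 (key j l hjl))
  simpa using Fintype.card_le_of_injective _ hinj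

/-- A bounded sequence which contracts at unit rate over windows tends to zero. -/
theorem tendsto_zero_of_window_contraction {t V : ℕ → ℝ} (htop : Tendsto t atTop atTop)
    (hmono : Monotone t) {C : ℝ} (hV0 : ∀ k, 0 ≤ V k) (hVC : ∀ k, V k ≤ C)
    (h : ∀ ε > 0, ∃ c > 0, ∀ᶠ m in atTop, ∃ k, c ≤ t m - t k ∧ t m - t k ≤ 1 ∧
      V m * (1 + (t m - t k)) ≤ V k + ε * (t m - t k)) :
    Tendsto V atTop (𝓝 0) := by
  have hC : 0 ≤ C := (hV0 0).trans (hVC 0)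
  have main : ∀ ε > 0, ∀ᶠ m in atTop, V m ≤ ε + ε := by
    intro ε hε
    obtain ⟨c, hc, hw⟩ := h ε hε
    -- Each window has length at least `c`, so going back one window shrinks the excess over `ε` by
    -- the factor `1 / (1 + c)`.
    have hind : ∀ n : ℕ, ∀ᶠ m in atTop, V m ≤ ε + C * (1 / (1 + c)) ^ n := by
      intro n
      induction n with
      | zero => exact Eventually.of_forall fun m => by simpa using (hVC m).trans (by linarith)
      | succ n ih =>
        obtain ⟨K, hK⟩ := eventually_atTop.1 ih
        filter_upwards [hw, htop.eventually_gt_atTop (t K + 1)] with m ⟨k, hk1, hk2, hk3⟩ hm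
        have hKk : K ≤ k := by
          by_contra! hlt
          linarith [hmono hlt.le]
        have hVk := hK k hKk
        set D := C * (1 / (1 + c)) ^ n
        have hD : 0 ≤ D := by positivity
        have h1 : D * (1 / (1 + c)) * (1 + (t m - t k)) ≥ D := by
          rw [mul_assoc, ge_iff_le]
          refine le_mul_of_one_le_right hD ?_
          rw [one_div, inv_mul_eq_div, one_le_div (by linarith)]
          linarith
        have h2 : V m * (1 + (t m - t k)) ≤ (ε + D * (1 / (1 + c))) * (1 + (t m - t k)) := by
          linarith
        rw [pow_succ, ← mul_assoc]
        exact le_of_mul_le_mul_right h2 (by linarith)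
    have hlim : Tendsto (fun n : ℕ => C * (1 / (1 + c)) ^ n) atTop (𝓝 0) := by
      simpa using (tendsto_pow_atTop_nhds_zero_of_lt_one (r := 1 / (1 + c)) (by positivity)
        (by rw [div_lt_one (by linarith)]; linarith)).const_mul C
    obtain ⟨n, hn⟩ := (hlim.eventually_lt_const hε).exists
    filter_upwards [hind n] with m hm
    linarith
  refine tendsto_order.2 ⟨fun a ha => Eventually.of_forall fun k => ha.trans_le (hV0 k),
    fun a ha => ?_⟩
  filter_upwards [main (a / 4) (by linarith)] with m hm
  linarith

/-- A slowly varying nonnegative sequence which is summable against divergent weights tends to zero. -/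
theorem tendsto_zero_of_summable_mul {β V : ℕ → ℝ} (hβ : ∀ k, 0 ≤ β k)
    (htop : Tendsto (fun n => ∑ k ∈ Finset.range n, β k) atTop atTop)
    (hlim : Tendsto β atTop (𝓝 0)) (hV : ∀ k, 0 ≤ V k)
    (hsum : Summable fun k => β k * V k) {C : ℝ}
    (hC : ∀ k, |V (k + 1) - V k| ≤ C * β k) :
    Tendsto V atTop (𝓝 0) := by
  set t : ℕ → ℝ := fun n => ∑ k ∈ Finset.range n, β k with ht
  have ht1 : ∀ k, t (k + 1) - t k = β k := fun k => by simp [ht, Finset.sum_range_succ]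
  have hmono : Monotone t := monotone_nat_of_le_succ fun k => by linarith [ht1 k, hβ k]
  have hVlip : ∀ k m, k ≤ m → V m ≤ V k + C * (t m - t k) := by
    intro k m hkm
    induction m, hkm using Nat.le_induction with
    | base => simp
    | succ m _ ih =>
      have := (abs_le.1 (hC m)).2
      rw [← ht1] at this
      linarith
  have htail : Tendsto (fun n => ∑ k ∈ Finset.range n, β k * V k) atTop
      (𝓝 (∑' k, β k * V k)) := hsum.hasSum.tendsto_sum_nat
  set Q : ℕ → ℝ := fun n => ∑ k ∈ Finset.range n, β k * V k with hQ
  have hwin : ∀ v k m, k ≤ m → (∀ l, k ≤ l → l < m → v ≤ V l) →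
      v * (t m - t k) ≤ Q m - Q k := by
    intro v k m hkm
    induction m, hkm using Nat.le_induction with
    | base => simp
    | succ m hkm ih =>
      intro h
      have h1 := ih fun l hl hlm => h l hl (by omega)
      have h2 : Q (m + 1) - Q m = β m * V m := by simp [hQ, Finset.sum_range_succ]
      have h3 := mul_le_mul_of_nonneg_left (h m hkm (by omega)) (hβ m)
      rw [← ht1] at h2 h3
      nlinarith
  have hC0 : ∀ k, 0 ≤ C * β k := fun k => (abs_nonneg _).trans (hC k)
  have main : ∀ ε > 0, ∀ᶠ m in atTop, V m ≤ ε := by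
    intro ε hε
    -- Within time `s` before `m`, `V` stays above `V m - ε / 2`. If `V m > ε`, a window of length
    -- at least `s / 2` contributes at least `ε * s / 4` to the sum, whereas late windows contribute
    -- less than `ε * s / 8`.
    set s : ℝ := ε / (2 * (|C| + 1)) with hs
    have hs0 : 0 < s := by positivity
    have hCs : |C| * s ≤ ε / 2 := by
      rw [hs, mul_div_assoc', div_le_iff₀ (by positivity)]
      nlinarith [abs_nonneg C]
    have hpos : 0 < ε * s / 16 := by positivity
    obtain ⟨K, hK⟩ := eventually_atTop.1 ((Metric.tendsto_nhds.1 htail) _ hpos)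
    filter_upwards [eventually_exists_window hmono htop (by simpa only [ht1] using hlim) hs0 K,
      eventually_ge_atTop K] with m ⟨k, hKk, hkm, h1, h2⟩ hKm
    have hq1 := abs_lt.1 (by simpa [Real.dist_eq] using hK m hKm)
    have hq2 := abs_lt.1 (by simpa [Real.dist_eq] using hK k hKk)
    have h3 := hwin (V m - ε / 2) k m hkm fun l hkl hlm => by
      have e1 := hVlip l m hlm.le
      have e2 : C * (t m - t l) ≤ |C| * s :=
        mul_le_mul (le_abs_self C) (by linarith [hmono hkl]) (by linarith [hmono hlm.le])
          (abs_nonneg C)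
      linarith
    by_contra! hlt
    have h4 : ε / 2 * (s / 2) ≤ (V m - ε / 2) * (t m - t k) :=
      mul_le_mul (by linarith) h1 (by positivity) (by linarith)
    linarith
  refine tendsto_order.2 ⟨fun a ha => Eventually.of_forall fun k => ha.trans_le (hV k),
    fun a ha => ?_⟩
  filter_upwards [main (a / 2) (by linarith)] with m hm
  linarith

/-! ### Payoffs and exploitability in polymatrix games. -/

section Polymatrix

variable {N : ℕ} {A : Type*} [Fintype A]

/-- Products of mixed strategies. -/
def mixedProfiles (N : ℕ) (A : Type*) [Fintype A] : Set (Fin N → A → ℝ) :=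
  {π | ∀ i, π i ∈ stdSimplex ℝ A}

/-- Expectation of `f` under the product of the strategies `π j`. -/
def profileExpectation (f : (Fin N → A) → ℝ) (π : Fin N → A → ℝ) : ℝ :=
  ∑ a : Fin N → A, f a * ∏ j, π j (a j)

/-- Expected reward of player `i` for the action `b` in the polymatrix game with pairwise
rewards `r`. -/
def polyPayoff (r : Fin N → Fin N → A → A → ℝ) (i : Fin N) (b : A) (π : Fin N → A → ℝ) : ℝ :=
  ∑ j ∈ Finset.univ.erase i, ∑ c, r i j b c * π j c

/-- Best response value of player `i`. -/
noncomputable def bestPayoff (r : Fin N → Fin N → A → A → ℝ) (i : Fin N) (π : Fin N → A → ℝ) : ℝ :=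
  ⨆ b, polyPayoff r i b π

/-- Sum of the expected rewards when each player `i` plays `x i` while the others play `π`. -/
def totalPayoff (r : Fin N → Fin N → A → A → ℝ) (x π : Fin N → A → ℝ) : ℝ :=
  ∑ i, ∑ b, x i b * polyPayoff r i b π

/-- Sum of the gains from unilateral deviations. -/
noncomputable def exploitability (r : Fin N → Fin N → A → A → ℝ) (π : Fin N → A → ℝ) : ℝ :=
  ∑ i, bestPayoff r i π - totalPayoff r π π

/-- A Lipschitz constant for all payoffs. -/
def payoffBound (r : Fin N → Fin N → A → A → ℝ) : ℝ :=
  1 + ∑ i, ∑ b, ∑ j, ∑ c, |r i j b c|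

variable (r : Fin N → Fin N → A → A → ℝ)

theorem payoffBound_pos : 0 < payoffBound r := by
  unfold payoffBound; positivity

theorem polyPayoff_add (i : Fin N) (b : A) (x y : Fin N → A → ℝ) :
    polyPayoff r i b (x + y) = polyPayoff r i b x + polyPayoff r i b y := by
  simp only [polyPayoff, Pi.add_apply, mul_add, Finset.sum_add_distrib]

theorem polyPayoff_smul (i : Fin N) (b : A) (s : ℝ) (x : Fin N → A → ℝ) :
    polyPayoff r i b (s • x) = s * polyPayoff r i b x := by
  simp only [polyPayoff, Pi.smul_apply, smul_eq_mul, Finset.mul_sum]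
  exact Finset.sum_congr rfl fun j _ => Finset.sum_congr rfl fun c _ => by ring

theorem polyPayoff_sub (i : Fin N) (b : A) (x y : Fin N → A → ℝ) :
    polyPayoff r i b (x - y) = polyPayoff r i b x - polyPayoff r i b y := by
  simp only [polyPayoff, Pi.sub_apply, mul_sub, Finset.sum_sub_distrib]

theorem abs_polyPayoff_le (i : Fin N) (b : A) (x : Fin N → A → ℝ) :
    |polyPayoff r i b x| ≤ payoffBound r * ‖x‖ := by
  have h1 : |polyPayoff r i b x| ≤ ∑ j ∈ Finset.univ.erase i, ∑ c, |r i j b c| * ‖x‖ := by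
    refine (Finset.abs_sum_le_sum_abs _ _).trans (Finset.sum_le_sum fun j _ =>
      (Finset.abs_sum_le_sum_abs _ _).trans (Finset.sum_le_sum fun c _ => ?_))
    rw [abs_mul]
    exact mul_le_mul_of_nonneg_left ((norm_le_pi_norm (x j) c).trans (norm_le_pi_norm x j))
      (abs_nonneg _)
  refine h1.trans ?_
  simp_rw [← Finset.sum_mul]
  refine mul_le_mul_of_nonneg_right ?_ (norm_nonneg x)
  have h2 : ∑ j ∈ Finset.univ.erase i, ∑ c, |r i j b c| ≤ ∑ j, ∑ c, |r i j b c| :=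
    Finset.sum_le_sum_of_subset_of_nonneg (Finset.subset_univ _) fun _ _ _ => by positivity
  have h3 : ∑ j, ∑ c, |r i j b c| ≤ ∑ b, ∑ j, ∑ c, |r i j b c| :=
    Finset.single_le_sum (f := fun b => ∑ j, ∑ c, |r i j b c|) (fun _ _ => by positivity)
      (Finset.mem_univ b)
  have h4 : ∑ b, ∑ j, ∑ c, |r i j b c| ≤ ∑ i, ∑ b, ∑ j, ∑ c, |r i j b c| :=
    Finset.single_le_sum (f := fun i => ∑ b, ∑ j, ∑ c, |r i j b c|) (fun _ _ => by positivity)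
      (Finset.mem_univ i)
  unfold payoffBound
  linarith

theorem abs_polyPayoff_sub_le (i : Fin N) (b : A) (x y : Fin N → A → ℝ) :
    |polyPayoff r i b x - polyPayoff r i b y| ≤ payoffBound r * ‖x - y‖ := by
  rw [← polyPayoff_sub]
  exact abs_polyPayoff_le r i b _

theorem polyPayoff_update (i : Fin N) (b : A) (x : Fin N → A → ℝ) (p : A → ℝ) :
    polyPayoff r i b (Function.update x i p) = polyPayoff r i b x := by
  refine Finset.sum_congr rfl fun j hj => ?_
  rw [Function.update_of_ne (Finset.ne_of_mem_erase hj)]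

theorem polyPayoff_le_bestPayoff (i : Fin N) (b : A) (x : Fin N → A → ℝ) :
    polyPayoff r i b x ≤ bestPayoff r i x :=
  le_ciSup (f := fun b => polyPayoff r i b x) (Set.finite_range _).bddAbove b

theorem bestPayoff_le [Nonempty A] {i : Fin N} {x : Fin N → A → ℝ} {v : ℝ}
    (h : ∀ b, polyPayoff r i b x ≤ v) : bestPayoff r i x ≤ v :=
  ciSup_le h

theorem abs_bestPayoff_sub_le [Nonempty A] (i : Fin N) (x y : Fin N → A → ℝ) :
    |bestPayoff r i x - bestPayoff r i y| ≤ payoffBound r * ‖x - y‖ := by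
  have key : ∀ x y, bestPayoff r i x ≤ bestPayoff r i y + payoffBound r * ‖x - y‖ := fun x y =>
    bestPayoff_le r fun b => by
      linarith [(abs_le.1 (abs_polyPayoff_sub_le r i b x y)).2, polyPayoff_le_bestPayoff r i b y]
  have h1 := key x y
  have h2 := key y x
  rw [norm_sub_rev] at h2
  exact abs_le.2 ⟨by linarith, by linarith⟩

theorem sum_mul_le_of_mem_stdSimplex {p f : A → ℝ} (hp : p ∈ stdSimplex ℝ A) {v : ℝ}
    (h : ∀ b, f b ≤ v) : ∑ b, p b * f b ≤ v :=
  calc ∑ b, p b * f b ≤ ∑ b, p b * v :=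
        Finset.sum_le_sum fun b _ => mul_le_mul_of_nonneg_left (h b) (hp.1 b)
    _ = v := by rw [← Finset.sum_mul, hp.2, one_mul]

theorem totalPayoff_le_sum_bestPayoff {x : Fin N → A → ℝ} (hx : x ∈ mixedProfiles N A)
    (π : Fin N → A → ℝ) : totalPayoff r x π ≤ ∑ i, bestPayoff r i π :=
  Finset.sum_le_sum fun i _ =>
    sum_mul_le_of_mem_stdSimplex (hx i) fun b => polyPayoff_le_bestPayoff r i b π

/-- Each `x i` puts its mass on `δ`-best responses, so averaging costs every player at most `δ`. -/
theorem sum_bestPayoff_le_totalPayoff_add {x π : Fin N → A → ℝ} (hx : x ∈ mixedProfiles N A)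
    {δ : ℝ} (h : ∀ i b, x i b ≠ 0 → bestPayoff r i π ≤ polyPayoff r i b π + δ) :
    ∑ i, bestPayoff r i π ≤ totalPayoff r x π + N * δ := by
  have h1 : ∀ i, bestPayoff r i π ≤ ∑ b, x i b * polyPayoff r i b π + δ := by
    intro i
    have h2 : ∑ b, x i b * (bestPayoff r i π - δ) ≤ ∑ b, x i b * polyPayoff r i b π := by
      refine Finset.sum_le_sum fun b _ => ?_
      by_cases hb : x i b = 0
      · simp [hb]
      · exact mul_le_mul_of_nonneg_left (by linarith [h i b hb]) ((hx i).1 b)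
    rw [← Finset.sum_mul, (hx i).2, one_mul] at h2
    linarith
  refine (Finset.sum_le_sum fun i _ => h1 i).trans ?_
  simp [totalPayoff, Finset.sum_add_distrib]

theorem exploitability_nonneg {x : Fin N → A → ℝ} (hx : x ∈ mixedProfiles N A) :
    0 ≤ exploitability r x :=
  sub_nonneg.2 (totalPayoff_le_sum_bestPayoff r hx x)

theorem totalPayoff_add_right (x y z : Fin N → A → ℝ) :
    totalPayoff r x (y + z) = totalPayoff r x y + totalPayoff r x z := by
  simp only [totalPayoff, polyPayoff_add, mul_add, Finset.sum_add_distrib]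

theorem totalPayoff_sub_right (x y z : Fin N → A → ℝ) :
    totalPayoff r x (y - z) = totalPayoff r x y - totalPayoff r x z := by
  simp only [totalPayoff, polyPayoff_sub, mul_sub, Finset.sum_sub_distrib]

theorem totalPayoff_smul_right (s : ℝ) (x y : Fin N → A → ℝ) :
    totalPayoff r x (s • y) = s * totalPayoff r x y := by
  simp only [totalPayoff, polyPayoff_smul, Finset.mul_sum]
  exact Finset.sum_congr rfl fun j _ => Finset.sum_congr rfl fun c _ => by ring

theorem abs_totalPayoff_le {x : Fin N → A → ℝ} (hx : x ∈ mixedProfiles N A)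
    (y : Fin N → A → ℝ) : |totalPayoff r x y| ≤ N * (payoffBound r * ‖y‖) := by
  have h1 : ∀ i, |∑ b, x i b * polyPayoff r i b y| ≤ payoffBound r * ‖y‖ := by
    intro i
    refine (Finset.abs_sum_le_sum_abs _ _).trans ?_
    simp_rw [abs_mul, abs_of_nonneg ((hx i).1 _)]
    exact sum_mul_le_of_mem_stdSimplex (hx i) fun b => abs_polyPayoff_le r i b y
  refine (Finset.abs_sum_le_sum_abs _ _).trans ((Finset.sum_le_sum fun i _ => h1 i).trans ?_)
  simp

theorem totalPayoff_sub_left (x y z : Fin N → A → ℝ) :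
    totalPayoff r (x - y) z = totalPayoff r x z - totalPayoff r y z := by
  simp only [totalPayoff, Pi.sub_apply, sub_mul, Finset.sum_sub_distrib]

theorem continuous_polyPayoff (i : Fin N) (b : A) : Continuous (polyPayoff r i b) := by
  unfold polyPayoff; fun_prop

theorem continuous_bestPayoff [Nonempty A] (i : Fin N) : Continuous (bestPayoff r i) := by
  have := LipschitzWith.of_dist_le_mul (f := bestPayoff r i) (K := (payoffBound r).toNNReal)
    fun x y => by
      rw [Real.dist_eq, dist_eq_norm, Real.coe_toNNReal _ (payoffBound_pos r).le]
      exact abs_bestPayoff_sub_le r i x y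
  exact this.continuous

theorem continuous_exploitability [Nonempty A] : Continuous (exploitability r) := by
  unfold exploitability totalPayoff
  have h1 := continuous_polyPayoff r
  have h2 := continuous_bestPayoff r
  fun_prop

theorem norm_le_one_of_mem_mixedProfiles {x : Fin N → A → ℝ} (hx : x ∈ mixedProfiles N A) :
    ‖x‖ ≤ 1 := by
  refine (pi_norm_le_iff_of_nonneg zero_le_one).2 fun i =>
    (pi_norm_le_iff_of_nonneg zero_le_one).2 fun b => ?_
  rw [Real.norm_eq_abs, abs_of_nonneg ((hx i).1 b)]
  exact (mem_Icc_of_mem_stdSimplex (hx i) b).2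

theorem norm_sub_le_one_of_mem_mixedProfiles {x y : Fin N → A → ℝ} (hx : x ∈ mixedProfiles N A)
    (hy : y ∈ mixedProfiles N A) : ‖x - y‖ ≤ 1 := by
  refine (pi_norm_le_iff_of_nonneg zero_le_one).2 fun i =>
    (pi_norm_le_iff_of_nonneg zero_le_one).2 fun b => ?_
  have h1 := mem_Icc_of_mem_stdSimplex (hx i) b
  have h2 := mem_Icc_of_mem_stdSimplex (hy i) b
  rw [Real.norm_eq_abs, Pi.sub_apply, Pi.sub_apply]
  exact abs_le.2 ⟨by linarith [h1.1, h2.2], by linarith [h1.2, h2.1]⟩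

/-- The exploitability varies slowly. -/
theorem abs_exploitability_sub_le [Nonempty A] {x y : Fin N → A → ℝ}
    (hx : x ∈ mixedProfiles N A) (hy : y ∈ mixedProfiles N A) :
    |exploitability r x - exploitability r y| ≤
      (2 * N + N * Fintype.card A) * payoffBound r * ‖x - y‖ := by
  have h1 : |∑ i, (bestPayoff r i x - bestPayoff r i y)| ≤ N * (payoffBound r * ‖x - y‖) := by
    refine (Finset.abs_sum_le_sum_abs _ _).trans
      ((Finset.sum_le_sum fun i _ => abs_bestPayoff_sub_le r i x y).trans ?_)
    simp
  have h2 := abs_totalPayoff_le r hx (x - y)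
  have h3 : |totalPayoff r (x - y) y| ≤ N * (Fintype.card A * (‖x - y‖ * payoffBound r)) := by
    have h4 : ∀ i, |∑ b, (x - y) i b * polyPayoff r i b y| ≤
        Fintype.card A * (‖x - y‖ * payoffBound r) := by
      intro i
      have h5 : ∀ b, |(x - y) i b * polyPayoff r i b y| ≤ ‖x - y‖ * payoffBound r := by
        intro b
        rw [abs_mul]
        refine mul_le_mul ((norm_le_pi_norm ((x - y) i) b).trans (norm_le_pi_norm (x - y) i))
          ((abs_polyPayoff_le r i b y).trans ?_) (abs_nonneg _) (norm_nonneg _)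
        exact mul_le_of_le_one_right (payoffBound_pos r).le (norm_le_one_of_mem_mixedProfiles hy)
      refine (Finset.abs_sum_le_sum_abs _ _).trans ((Finset.sum_le_sum fun b _ => h5 b).trans ?_)
      simp
    refine (Finset.abs_sum_le_sum_abs _ _).trans ((Finset.sum_le_sum fun i _ => h4 i).trans ?_)
    simp
  rw [Finset.sum_sub_distrib] at h1
  rw [totalPayoff_sub_right] at h2
  rw [totalPayoff_sub_left] at h3
  -- The two arguments of `totalPayoff` are changed one after the other.
  have e : exploitability r x - exploitability r y =
      (∑ i, bestPayoff r i x - ∑ i, bestPayoff r i y) -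
        (totalPayoff r x x - totalPayoff r x y) - (totalPayoff r x y - totalPayoff r y y) := by
    unfold exploitability; ring
  rw [e]
  refine (abs_sub _ _).trans ?_
  have := abs_sub (∑ i, bestPayoff r i x - ∑ i, bestPayoff r i y)
    (totalPayoff r x x - totalPayoff r x y)
  linarith

theorem isCompact_mixedProfiles : IsCompact (mixedProfiles N A) := by
  have : mixedProfiles N A = Set.univ.pi fun _ : Fin N => stdSimplex ℝ A := by
    ext; simp [mixedProfiles]
  rw [this]
  exact isCompact_univ_pi fun _ => isCompact_stdSimplex ℝ A

theorem convex_mixedProfiles : Convex ℝ (mixedProfiles N A) := by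
  have : mixedProfiles N A = Set.univ.pi fun _ : Fin N => stdSimplex ℝ A := by
    ext; simp [mixedProfiles]
  rw [this]
  exact convex_pi fun _ _ => convex_stdSimplex ℝ A

end Polymatrix

/-! ### Expectations under product strategies, and Nash equilibria. -/

section Expectation

variable {N : ℕ} {A : Type*} [Fintype A]

/-- Conditioning on the actions of the players other than `i` isolates the strategy `π i`. -/
theorem profileExpectation_split (f : (Fin N → A) → ℝ) (i : Fin N) (π : Fin N → A → ℝ) :
    profileExpectation f π = ∑ c : {j // j ≠ i} → A, (∏ j : {j // j ≠ i}, π j (c j)) *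
      ∑ b, π i b * f ((Equiv.funSplitAt i A).symm (b, c)) := by
  classical
  rw [profileExpectation, ← (Equiv.funSplitAt i A).symm.sum_comp, Fintype.sum_prod_type_right]
  refine Finset.sum_congr rfl fun c _ => ?_
  rw [Finset.mul_sum]
  refine Finset.sum_congr rfl fun b _ => ?_
  rw [Fintype.prod_eq_mul_prod_subtype_ne _ i]
  have h : ∀ j : {j // j ≠ i}, (Equiv.funSplitAt i A).symm (b, c) j = c j := fun j => by
    simp [Equiv.funSplitAt, Equiv.piSplitAt, j.2]
  have h' : (Equiv.funSplitAt i A).symm (b, c) i = b := by simp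
  simp only [h, h']
  ring

/-- A function that ignores the `i`-th action has an expectation that ignores the `i`-th
strategy. -/
theorem profileExpectation_update_of_forall_update_eq [DecidableEq A] {f : (Fin N → A) → ℝ}
    {i : Fin N} (hf : ∀ a b, f (Function.update a i b) = f a) {π : Fin N → A → ℝ} {p : A → ℝ}
    (hπ : ∑ b, π i b = 1) (hp : ∑ b, p b = 1) :
    profileExpectation f (Function.update π i p) = profileExpectation f π := by
  rw [profileExpectation_split f i, profileExpectation_split f i]
  refine Finset.sum_congr rfl fun c _ => ?_
  have h1 : ∀ j : {j // j ≠ i}, Function.update π i p j = π j := fun j => by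
    rw [Function.update_of_ne j.2]
  have h2 : ∀ b b', f ((Equiv.funSplitAt i A).symm (b, c)) =
      f ((Equiv.funSplitAt i A).symm (b', c)) := by
    intro b b'
    rw [← hf _ b']
    congr 1
    funext j
    by_cases hj : j = i
    · subst hj; simp
    · simp [hj, Equiv.funSplitAt, Equiv.piSplitAt]
  have h3 : ∀ (q q' : A → ℝ), ∑ b, q b = 1 → ∑ b, q' b = 1 →
      ∑ b, q b * f ((Equiv.funSplitAt i A).symm (b, c)) =
        ∑ b, q' b * f ((Equiv.funSplitAt i A).symm (b, c)) := by
    intro q q' hq hq'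
    rcases isEmpty_or_nonempty A with _ | ⟨⟨b₀⟩⟩
    · simp
    · simp only [h2 _ b₀, ← Finset.sum_mul, hq, hq']
  simp only [h1, Function.update_self]
  rw [h3 p (π i) hp hπ]

theorem profileExpectation_sub (f g : (Fin N → A) → ℝ) (π : Fin N → A → ℝ) :
    profileExpectation (fun a => f a - g a) π =
      profileExpectation f π - profileExpectation g π := by
  simp only [profileExpectation, sub_mul, Finset.sum_sub_distrib]

theorem profileExpectation_prod (F : Fin N → A → ℝ) (π : Fin N → A → ℝ) :
    profileExpectation (fun a => ∏ j, F j (a j)) π = ∏ j, ∑ b, F j b * π j b := by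
  classical
  simp only [profileExpectation, ← Finset.prod_mul_distrib]
  rw [Finset.prod_univ_sum, Fintype.piFinset_univ]

/-- The indicator of a pair of actions is a product of one-player functions, so its expectation
factors and all other players contribute total mass one. A general `f` is a combination of such
indicators. -/
theorem profileExpectation_pair {i j : Fin N} (hij : i ≠ j) (f : A → A → ℝ) {π : Fin N → A → ℝ}
    (hπ : ∀ i, ∑ b, π i b = 1) :
    profileExpectation (fun a => f (a i) (a j)) π = ∑ b, ∑ c, π i b * (f b c * π j c) := by
  classical
  have h1 : ∀ b c, profileExpectation (fun a => if a i = b ∧ a j = c then 1 else 0) π =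
      π i b * π j c := by
    intro b c
    set F : Fin N → A → ℝ := fun l d =>
      (if l = i then (if d = b then 1 else 0) else 1) * (if l = j then (if d = c then 1 else 0) else 1)
    have hF : (fun a : Fin N → A => if a i = b ∧ a j = c then (1 : ℝ) else 0) =
        fun a => ∏ l, F l (a l) := by
      funext a
      simp only [F, Finset.prod_mul_distrib, Finset.prod_ite_eq', Finset.mem_univ, if_true]
      split_ifs <;> simp_all
    have h2 : ∀ l, ∑ d, F l d * π l d = (if l = i then π i b else 1) *
        (if l = j then π j c else 1) := by
      intro l
      by_cases hi : l = i
      · subst hi; simp [F, hij]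
      · by_cases hj : l = j
        · subst hj; simp [F, hi]
        · simp [F, hi, hj, hπ]
    rw [hF, profileExpectation_prod]
    simp only [h2, Finset.prod_mul_distrib, Finset.prod_ite_eq', Finset.mem_univ, if_true]
  have h3 : profileExpectation (fun a => f (a i) (a j)) π =
      ∑ b, ∑ c, f b c * profileExpectation (fun a => if a i = b ∧ a j = c then 1 else 0) π := by
    simp only [profileExpectation, Finset.mul_sum]
    simp_rw [Finset.sum_comm (s := (Finset.univ : Finset A)) (t := (Finset.univ : Finset (Fin N → A)))]
    refine Finset.sum_congr rfl fun a _ => ?_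
    simp [ite_and]
  rw [h3]
  simp only [h1]
  exact Finset.sum_congr rfl fun b _ => Finset.sum_congr rfl fun c _ => by ring

theorem profileExpectation_sum {ι : Type*} (s : Finset ι) (f : ι → (Fin N → A) → ℝ)
    (π : Fin N → A → ℝ) : profileExpectation (fun a => ∑ l ∈ s, f l a) π =
      ∑ l ∈ s, profileExpectation (f l) π := by
  simp only [profileExpectation, Finset.sum_mul]
  exact Finset.sum_comm

theorem abs_profileExpectation_le (f : (Fin N → A) → ℝ) {π : Fin N → A → ℝ}
    (hπ : π ∈ mixedProfiles N A) : |profileExpectation f π| ≤ ∑ a, |f a| := by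
  refine (Finset.abs_sum_le_sum_abs _ _).trans (Finset.sum_le_sum fun a _ => ?_)
  rw [abs_mul, Finset.abs_prod]
  refine mul_le_of_le_one_right (abs_nonneg _) (Finset.prod_le_one (fun _ _ => abs_nonneg _) ?_)
  intro j _
  have := mem_Icc_of_mem_stdSimplex (hπ j) (a j)
  rw [abs_of_nonneg this.1]
  exact this.2

theorem MatrixGame.expectedReward_eq_profileExpectation (G : MatrixGame N A) (i : Fin N)
    (π : Fin N → A → ℝ) : G.expectedReward i π = profileExpectation (G.reward i) π := rfl

theorem MatrixGame.expectedReward_eq_sum_polyPayoff {G : MatrixGame N A}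
    {r : Fin N → Fin N → A → A → ℝ}
    (hr : ∀ i a, G.reward i a = ∑ j ∈ Finset.univ.erase i, r i j (a i) (a j))
    (i : Fin N) {π : Fin N → A → ℝ} (hπ : ∀ i, ∑ b, π i b = 1) :
    G.expectedReward i π = ∑ b, π i b * polyPayoff r i b π := by
  rw [MatrixGame.expectedReward_eq_profileExpectation, funext (hr i), profileExpectation_sum]
  have : ∀ j ∈ Finset.univ.erase i, profileExpectation (fun a => r i j (a i) (a j)) π =
      ∑ b, ∑ c, π i b * (r i j b c * π j c) := fun j hj =>
    profileExpectation_pair (Finset.ne_of_mem_erase hj).symm (r i j) hπ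
  rw [Finset.sum_congr rfl this, Finset.sum_comm]
  simp only [polyPayoff, Finset.mul_sum]

/-- On the diagonal, `totalPayoff` is the sum of the expected rewards, whatever decomposition `r` is
chosen; the pairwise games need not be zero-sum. -/
theorem MatrixGame.IsZeroSum.totalPayoff_self {G : MatrixGame N A} (hG : G.IsZeroSum)
    {r : Fin N → Fin N → A → A → ℝ}
    (hr : ∀ i a, G.reward i a = ∑ j ∈ Finset.univ.erase i, r i j (a i) (a j))
    {π : Fin N → A → ℝ} (hπ : ∀ i, ∑ b, π i b = 1) : totalPayoff r π π = 0 := by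
  unfold totalPayoff
  simp_rw [← MatrixGame.expectedReward_eq_sum_polyPayoff hr _ hπ,
    MatrixGame.expectedReward_eq_profileExpectation]
  rw [← profileExpectation_sum]
  simp [profileExpectation, hG _]

/-- Changing one strategy changes the expected potential by the change in expected reward. -/
theorem MatrixGame.profileExpectation_update_sub [DecidableEq A] {G : MatrixGame N A}
    {r : Fin N → Fin N → A → A → ℝ}
    (hr : ∀ i a, G.reward i a = ∑ j ∈ Finset.univ.erase i, r i j (a i) (a j))
    {φ : (Fin N → A) → ℝ}
    (hφ : ∀ (i : Fin N) (a : Fin N → A) (b : A),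
      G.reward i (Function.update a i b) - G.reward i a = φ (Function.update a i b) - φ a)
    {π : Fin N → A → ℝ} (hπ : ∀ i, ∑ b, π i b = 1) (i : Fin N) {p : A → ℝ}
    (hp : ∑ b, p b = 1) :
    profileExpectation φ (Function.update π i p) - profileExpectation φ π =
      ∑ b, (p b - π i b) * polyPayoff r i b π := by
  -- Exactness of the potential says that `G.reward i - φ` ignores the action of player `i`.
  have h1 := profileExpectation_update_of_forall_update_eq (f := fun a => G.reward i a - φ a)
    (i := i) (fun a b => by linarith [hφ i a b]) (hπ i) hp
  rw [profileExpectation_sub, profileExpectation_sub] at h1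
  have hup : ∀ l, ∑ b, Function.update π i p l b = 1 := by
    intro l
    by_cases hl : l = i
    · subst hl; simpa using hp
    · simpa [hl] using hπ l
  have h2 := MatrixGame.expectedReward_eq_sum_polyPayoff hr i hup
  have h3 := MatrixGame.expectedReward_eq_sum_polyPayoff hr i hπ
  rw [MatrixGame.expectedReward_eq_profileExpectation] at h2 h3
  simp only [polyPayoff_update, Function.update_self] at h2
  simp only [sub_mul, Finset.sum_sub_distrib]
  linarith

/-- Profiles without profitable deviations are Nash equilibria. -/
theorem MatrixGame.mem_nashEquilibria_of_exploitability_eq_zero {G : MatrixGame N A}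
    {r : Fin N → Fin N → A → A → ℝ}
    (hr : ∀ i a, G.reward i a = ∑ j ∈ Finset.univ.erase i, r i j (a i) (a j))
    {π : Fin N → A → ℝ} (hπ : π ∈ mixedProfiles N A) (h : exploitability r π = 0) :
    π ∈ G.nashEquilibria := by
  refine ⟨hπ, fun i p hp => ?_⟩
  have hup : ∀ l, ∑ b, Function.update π i p l b = 1 := by
    intro l
    by_cases hl : l = i
    · subst hl; simpa using hp.2
    · simpa [hl] using (hπ l).2
  rw [MatrixGame.expectedReward_eq_sum_polyPayoff hr i hup,
    MatrixGame.expectedReward_eq_sum_polyPayoff hr i fun l => (hπ l).2]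
  simp only [polyPayoff_update, Function.update_self]
  have h1 : ∀ l, ∑ b, π l b * polyPayoff r l b π ≤ bestPayoff r l π := fun l =>
    sum_mul_le_of_mem_stdSimplex (hπ l) fun b => polyPayoff_le_bestPayoff r l b π
  have h2 : ∑ l, (bestPayoff r l π - ∑ b, π l b * polyPayoff r l b π) = 0 := by
    rw [Finset.sum_sub_distrib]; exact h
  have h3 := (Finset.sum_eq_zero_iff_of_nonneg fun l _ => sub_nonneg.2 (h1 l)).1 h2 i
    (Finset.mem_univ i)
  have h4 : ∑ b, p b * polyPayoff r i b π ≤ bestPayoff r i π :=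
    sum_mul_le_of_mem_stdSimplex hp fun b => polyPayoff_le_bestPayoff r i b π
  linarith

/-- By continuity, every cluster point has exploitability zero and is thus an equilibrium. Existence
of equilibria need not be known beforehand. -/
theorem MatrixGame.tendsto_infEDist_nashEquilibria [Nonempty A] {G : MatrixGame N A}
    {r : Fin N → Fin N → A → A → ℝ}
    (hr : ∀ i a, G.reward i a = ∑ j ∈ Finset.univ.erase i, r i j (a i) (a j))
    {x : ℕ → Fin N → A → ℝ} (hx : ∀ k, x k ∈ mixedProfiles N A)
    (h : Tendsto (fun k => exploitability r (x k)) atTop (𝓝 0)) :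
    Tendsto (fun k => Metric.infEDist (x k) G.nashEquilibria) atTop (𝓝 0) := by
  refine tendsto_of_subseq_tendsto fun ns hns => ?_
  obtain ⟨π, hπ, ms, hms, hlim⟩ := isCompact_mixedProfiles.tendsto_subseq fun k => hx (ns k)
  refine ⟨ms, ?_⟩
  have h1 := ((continuous_exploitability r).tendsto π).comp hlim
  have h2 : exploitability r π = 0 :=
    tendsto_nhds_unique h1 (h.comp (hns.comp hms.tendsto_atTop))
  have h3 := MatrixGame.mem_nashEquilibria_of_exploitability_eq_zero hr hπ h2
  refine tendsto_of_tendsto_of_tendsto_of_le_of_le tendsto_const_nhds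
    (tendsto_iff_edist_tendsto_0.1 hlim) (fun _ => bot_le) fun k => ?_
  exact Metric.infEDist_le_edist_of_mem h3

end Expectation

/-! ### Fictitious play with vanishing errors: the zero-sum case. -/

/-- The profile of point masses at the actions `a`. -/
def pureProfile {N : ℕ} {A : Type*} [DecidableEq A] (a : Fin N → A) : Fin N → A → ℝ := fun i => Pi.single (a i) 1

section FictitiousPlay

variable {N : ℕ} {A : Type*} [Fintype A] [DecidableEq A]

theorem pureProfile_mem_mixedProfiles (a : Fin N → A) : pureProfile a ∈ mixedProfiles N A :=
  fun i => single_mem_stdSimplex ℝ (a i)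

/-- Fictitious play in the polymatrix game with pairwise rewards `r`, where the actions `u k` are
`η k`-best responses to the frequencies `x k`. -/
structure PerturbedFictitiousPlay (r : Fin N → Fin N → A → A → ℝ) (β η : ℕ → ℝ)
    (u : ℕ → Fin N → A) (x : ℕ → Fin N → A → ℝ) : Prop where
  step_nonneg : ∀ k, 0 ≤ β k
  sum_step : Tendsto (fun n => ∑ k ∈ Finset.range n, β k) atTop atTop
  sq_summable : Summable fun k => β k ^ 2
  mem : ∀ k, x k ∈ mixedProfiles N A
  step : ∀ k, x (k + 1) = x k + β k • (pureProfile (u k) - x k)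
  error_tendsto : Tendsto η atTop (𝓝 0)
  error_summable : Summable fun k => β k * η k
  best : ∀ k i, bestPayoff r i (x k) ≤ polyPayoff r i (u k i) (x k) + η k

namespace PerturbedFictitiousPlay

variable {r : Fin N → Fin N → A → A → ℝ} {β η : ℕ → ℝ} {u : ℕ → Fin N → A}
  {x : ℕ → Fin N → A → ℝ}

theorem step_tendsto (h : PerturbedFictitiousPlay r β η u x) : Tendsto β atTop (𝓝 0) := by
  have h1 := h.sq_summable.tendsto_atTop_zero.sqrt
  simpa [Real.sqrt_sq (h.step_nonneg _)] using h1

theorem norm_succ_sub_le (h : PerturbedFictitiousPlay r β η u x) (k : ℕ) :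
    ‖x (k + 1) - x k‖ ≤ β k := by
  rw [h.step k, add_sub_cancel_left, norm_smul, Real.norm_of_nonneg (h.step_nonneg k)]
  exact mul_le_of_le_one_right (h.step_nonneg k)
    (norm_sub_le_one_of_mem_mixedProfiles (pureProfile_mem_mixedProfiles _) (h.mem k))

theorem monotone_time (h : PerturbedFictitiousPlay r β η u x) :
    Monotone fun n => ∑ k ∈ Finset.range n, β k :=
  monotone_nat_of_le_succ fun k => by
    simpa [Finset.sum_range_succ] using h.step_nonneg k

/-- With the partial sums of `β` as clock, the process moves at speed at most one, because profiles
are at sup-distance at most one. -/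
theorem norm_sub_le (h : PerturbedFictitiousPlay r β η u x) {k m : ℕ} (hkm : k ≤ m) :
    ‖x m - x k‖ ≤ ∑ l ∈ Finset.range m, β l - ∑ l ∈ Finset.range k, β l := by
  induction m, hkm using Nat.le_induction with
  | base => simp
  | succ m _ ih =>
    have h1 := norm_add_le (x (m + 1) - x m) (x m - x k)
    rw [sub_add_sub_cancel] at h1
    rw [Finset.sum_range_succ]
    linarith [h.norm_succ_sub_le m]

theorem sub_eq_sum (h : PerturbedFictitiousPlay r β η u x) {k m : ℕ} (hkm : k ≤ m) :
    x m - x k = ∑ l ∈ Finset.Ico k m, β l • (pureProfile (u l) - x l) := by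
  rw [← Finset.sum_Ico_sub x hkm]
  refine Finset.sum_congr rfl fun l _ => ?_
  rw [h.step l, add_sub_cancel_left]

/-- An action played between times `k` and `m` is a nearly best response at time `m`. -/
theorem bestPayoff_le_of_mem_Ico [Nonempty A] (h : PerturbedFictitiousPlay r β η u x) {l m : ℕ}
    (hlm : l ≤ m) (i : Fin N) :
    bestPayoff r i (x m) ≤ polyPayoff r i (u l i) (x m) +
      (2 * payoffBound r * (∑ l ∈ Finset.range m, β l - ∑ j ∈ Finset.range l, β j) + η l) := by
  have h1 := (abs_le.1 (abs_bestPayoff_sub_le r i (x m) (x l))).2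
  have h2 := (abs_le.1 (abs_polyPayoff_sub_le r i (u l i) (x m) (x l))).1
  have h3 := h.best l i
  have h4 := mul_le_mul_of_nonneg_left (h.norm_sub_le hlm) (payoffBound_pos r).le
  linarith

/-- If all actions played between times `k` and `m` are `δ`-best responses at time `m`, the sum of
the best response values contracts. -/
theorem sum_bestPayoff_mul_le (h : PerturbedFictitiousPlay r β η u x)
    (hz : ∀ π ∈ mixedProfiles N A, totalPayoff r π π = 0) {k m : ℕ} (hkm : k ≤ m) {τ δ : ℝ}
    (hτ : τ = ∑ l ∈ Finset.range m, β l - ∑ l ∈ Finset.range k, β l) (hτ0 : 0 < τ)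
    (hδ : ∀ l ∈ Finset.Ico k m, ∀ i,
      bestPayoff r i (x m) ≤ polyPayoff r i (u l i) (x m) + δ) :
    (∑ i, bestPayoff r i (x m)) * (1 + τ) ≤
      ∑ i, bestPayoff r i (x k) + N * payoffBound r * τ ^ 2 + N * δ * (1 + τ) := by
  have hsum : ∑ l ∈ Finset.Ico k m, β l = τ := by rw [hτ, Finset.sum_Ico_eq_sub _ hkm]
  set y : Fin N → A → ℝ := ∑ l ∈ Finset.Ico k m, (β l / τ) • pureProfile (u l) with hy
  have hymem : y ∈ mixedProfiles N A :=
    convex_mixedProfiles.sum_mem (fun l _ => div_nonneg (h.step_nonneg l) hτ0.le)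
      (by rw [← Finset.sum_div, hsum, div_self hτ0.ne'])
      fun l _ => pureProfile_mem_mixedProfiles _
  have hysupp : ∀ i b, y i b ≠ 0 → bestPayoff r i (x m) ≤ polyPayoff r i b (x m) + δ := by
    intro i b hb
    have h1 : y i b = ∑ l ∈ Finset.Ico k m, (β l / τ) * pureProfile (u l) i b := by
      simp [hy, Finset.sum_apply]
    rw [h1] at hb
    obtain ⟨l, hl, hne⟩ := Finset.exists_ne_zero_of_sum_ne_zero hb
    have h2 : b = u l i := by
      by_contra hne'
      simp [pureProfile, hne'] at hne
    rw [h2]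
    exact hδ l hl i
  -- The error of replacing every `x l` in the window by `x m`: total weight `τ`, each displacement
  -- at most `τ`.
  set e : Fin N → A → ℝ := ∑ l ∈ Finset.Ico k m, β l • (x m - x l) with he
  have hdecomp : x m - x k = τ • (y - x m) + e := by
    have h1 : τ • y = ∑ l ∈ Finset.Ico k m, β l • pureProfile (u l) := by
      rw [hy, Finset.smul_sum]
      refine Finset.sum_congr rfl fun l _ => ?_
      rw [smul_smul, mul_div_cancel₀ _ hτ0.ne']
    have h2 : τ • x m = ∑ l ∈ Finset.Ico k m, β l • x m := by
      rw [← hsum, Finset.sum_smul]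
    rw [h.sub_eq_sum hkm, smul_sub, h1, h2, he, ← Finset.sum_sub_distrib,
      ← Finset.sum_add_distrib]
    exact Finset.sum_congr rfl fun l _ => by module
  have henorm : ‖e‖ ≤ τ ^ 2 := by
    refine (norm_sum_le _ _).trans ?_
    rw [sq]
    nth_rewrite 1 [← hsum]
    rw [Finset.sum_mul]
    refine Finset.sum_le_sum fun l hl => ?_
    rw [norm_smul, Real.norm_of_nonneg (h.step_nonneg l)]
    have hl' := Finset.mem_Ico.1 hl
    refine mul_le_mul_of_nonneg_left ((h.norm_sub_le hl'.2.le).trans ?_) (h.step_nonneg l)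
    have := h.monotone_time hl'.1
    simp only at this
    linarith
  have h1 := sum_bestPayoff_le_totalPayoff_add r hymem hysupp
  have h2 := totalPayoff_le_sum_bestPayoff r hymem (x k)
  have h3 := (abs_le.1 (abs_totalPayoff_le r hymem e)).2
  -- The `0` is `totalPayoff r y y`; this is where the zero-sum property produces the contraction.
  have h4 : totalPayoff r y (x m - x k) = τ * (0 - totalPayoff r y (x m)) + totalPayoff r y e := by
    rw [hdecomp, totalPayoff_add_right, totalPayoff_smul_right, totalPayoff_sub_right, hz y hymem]
  rw [totalPayoff_sub_right] at h4
  have h5 : (N : ℝ) * (payoffBound r * ‖e‖) ≤ N * (payoffBound r * τ ^ 2) :=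
    mul_le_mul_of_nonneg_left (mul_le_mul_of_nonneg_left henorm (payoffBound_pos r).le)
      (Nat.cast_nonneg N)
  have h6 := mul_le_mul_of_nonneg_left h1 hτ0.le
  linarith

/-- Fictitious play in zero-sum polymatrix games. -/
theorem tendsto_exploitability_of_zeroSum [Nonempty A] (h : PerturbedFictitiousPlay r β η u x)
    (hz : ∀ π ∈ mixedProfiles N A, totalPayoff r π π = 0) :
    Tendsto (fun k => exploitability r (x k)) atTop (𝓝 0) := by
  have hV : ∀ k, exploitability r (x k) = ∑ i, bestPayoff r i (x k) := fun k => by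
    rw [exploitability, hz _ (h.mem k), sub_zero]
  have hL := payoffBound_pos r
  refine tendsto_zero_of_window_contraction h.sum_step h.monotone_time (C := N * payoffBound r)
    (fun k => exploitability_nonneg r (h.mem k)) (fun k => ?_) fun ε hε => ?_
  · rw [hV]
    have h1 : ∀ i, bestPayoff r i (x k) ≤ payoffBound r := fun i => bestPayoff_le r fun b =>
      (le_abs_self _).trans ((abs_polyPayoff_le r i b (x k)).trans
        (mul_le_of_le_one_right hL.le (norm_le_one_of_mem_mixedProfiles (h.mem k))))
    refine (Finset.sum_le_sum fun i _ => h1 i).trans ?_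
    simp
  -- The final error is `N * payoffBound r * (1 + 3 * 4 * 2) * τ ^ 2`, whence the `25`: one from
  -- linearization, and `24` from `δ = 3 * payoffBound r * s (j + 1)` with `s (j + 1) ≤ 4 * τ ^ 2`
  -- and `1 + τ ≤ 2`.
  set σ : ℝ := min 1 (ε / (25 * (N * payoffBound r) + 1)) with hσ
  have hσ0 : 0 < σ := by positivity
  have hσ1 : σ ≤ 1 := min_le_left _ _
  have hσε : 25 * (N * payoffBound r) * σ ≤ ε := by
    have h1 : σ * (25 * (N * payoffBound r) + 1) ≤ ε :=
      (le_div_iff₀ (by positivity)).1 (min_le_right _ _)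
    linarith
  -- Each scale is the square of the preceding one, so a regret below the next level is
  -- quadratically small in the window length.
  set s : ℕ → ℝ := fun j => σ ^ 2 ^ j with hs
  have hspos : ∀ j, 0 < s j := fun j => by positivity
  have hsanti : Antitone s := fun i j hij =>
    pow_le_pow_of_le_one hσ0.le hσ1 (Nat.pow_le_pow_right two_pos hij)
  have hssq : ∀ j, s (j + 1) = s j ^ 2 := fun j => by simp only [hs, pow_succ 2 j, pow_mul]
  have hs0 : ∀ j, s j ≤ σ := fun j => (hsanti (Nat.zero_le j)).trans (by simp [hs])
  set n := Fintype.card (Fin N × A) with hn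
  obtain ⟨K, hK⟩ := eventually_atTop.1
    (h.error_tendsto.eventually_le_const (mul_pos hL (hspos n)))
  refine ⟨s n / 2, half_pos (hspos n), ?_⟩
  have hwin : ∀ᶠ m in atTop, ∀ j ∈ Finset.range (n + 1), ∃ k, K ≤ k ∧ k ≤ m ∧
      s j / 2 ≤ ∑ l ∈ Finset.range m, β l - ∑ l ∈ Finset.range k, β l ∧
      ∑ l ∈ Finset.range m, β l - ∑ l ∈ Finset.range k, β l ≤ s j :=
    (Filter.eventually_all_finset _).2 fun j _ =>
      eventually_exists_window h.monotone_time h.sum_step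
        (by simpa [Finset.sum_range_succ] using h.step_tendsto) (hspos j) K
  filter_upwards [hwin] with m hm
  -- The scale depends on `m`, but ranges over finitely many values, so the window lengths stay
  -- above `s n / 2`.
  obtain ⟨j, hjn, hj⟩ := exists_level_gap
    (fun p : Fin N × A => bestPayoff r p.1 (x m) - polyPayoff r p.1 p.2 (x m))
    (s := fun j => 3 * payoffBound r * s j)
    fun i j hij => mul_le_mul_of_nonneg_left (hsanti hij) (by positivity)
  obtain ⟨k, hKk, hkm, h1, h2⟩ := hm j (Finset.mem_range.2 (by omega))
  set τ := ∑ l ∈ Finset.range m, β l - ∑ l ∈ Finset.range k, β l with hτ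
  have hτ0 : 0 < τ := (half_pos (hspos j)).trans_le h1
  refine ⟨k, by linarith [hsanti hjn], by linarith [hs0 j], ?_⟩
  -- Actions in the window have regret at most `2 * payoffBound r * s j` from the drift, plus an
  -- error of at most `payoffBound r * s n`. So their regret is below level `j`, and by the gap
  -- below level `j + 1`.
  have hgap := h.sum_bestPayoff_mul_le hz hkm hτ hτ0 (δ := 3 * payoffBound r * s (j + 1))
    fun l hl i => by
      have hl' := Finset.mem_Ico.1 hl
      have e1 := h.bestPayoff_le_of_mem_Ico hl'.2.le i
      have e2 := hK l (hKk.trans hl'.1)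
      have e3 : ∑ l ∈ Finset.range m, β l - ∑ j ∈ Finset.range l, β j ≤ s j := by
        have := h.monotone_time hl'.1
        simp only at this
        linarith
      have e4 := mul_le_mul_of_nonneg_left e3 hL.le
      have e5 := mul_le_mul_of_nonneg_left (hsanti hjn) hL.le
      linarith [hj (i, u l i) (by simp only; linarith)]
  rw [hV, hV]
  have hNL : 0 ≤ N * payoffBound r := by positivity
  have e1 : s (j + 1) ≤ 4 * τ ^ 2 := by rw [hssq]; nlinarith [hspos j]
  have e2 : (N : ℝ) * payoffBound r * s (j + 1) ≤ N * payoffBound r * (4 * τ ^ 2) :=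
    mul_le_mul_of_nonneg_left e1 hNL
  have e3 : τ ≤ σ := h2.trans (hs0 j)
  have e4 : (N : ℝ) * payoffBound r * s (j + 1) * (1 + τ) ≤ N * payoffBound r * (4 * τ ^ 2) * 2 :=
    mul_le_mul e2 (by linarith) (by linarith) (by positivity)
  have e5 : (N : ℝ) * payoffBound r * τ ^ 2 ≤ N * payoffBound r * (σ * τ) :=
    mul_le_mul_of_nonneg_left (by nlinarith) hNL
  have e6 : 25 * (N * payoffBound r) * σ * τ ≤ ε * τ := mul_le_mul_of_nonneg_right hσε hτ0.le
  linarith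

end PerturbedFictitiousPlay

/-! ### Fictitious play in potential games. -/

/-- First order expansion of the expected potential. -/
theorem MatrixGame.abs_profileExpectation_sub_le {G : MatrixGame N A}
    {r : Fin N → Fin N → A → A → ℝ}
    (hr : ∀ i a, G.reward i a = ∑ j ∈ Finset.univ.erase i, r i j (a i) (a j))
    {φ : (Fin N → A) → ℝ}
    (hφ : ∀ (i : Fin N) (a : Fin N → A) (b : A),
      G.reward i (Function.update a i b) - G.reward i a = φ (Function.update a i b) - φ a)
    {x y : Fin N → A → ℝ} (hx : x ∈ mixedProfiles N A) (hy : y ∈ mixedProfiles N A) :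
    |profileExpectation φ y - profileExpectation φ x - totalPayoff r (y - x) x| ≤
      N * (Fintype.card A * payoffBound r * ‖y - x‖ ^ 2) := by
  -- The players switch from `x` to `y` one at a time; each switch changes the expected potential
  -- exactly by a payoff difference at the current mixture, which is close to `x`.
  set mix : Finset (Fin N) → Fin N → A → ℝ := fun s i => if i ∈ s then y i else x i with hmix
  have hmem : ∀ s, mix s ∈ mixedProfiles N A := fun s i => by
    by_cases hi : i ∈ s
    · simpa [hmix, hi] using hy i
    · simpa [hmix, hi] using hx i
  have hnorm : ∀ s, ‖mix s - x‖ ≤ ‖y - x‖ := fun s =>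
    (pi_norm_le_iff_of_nonneg (norm_nonneg _)).2 fun i => by
      by_cases hi : i ∈ s
      · simpa [hmix, hi] using norm_le_pi_norm (y - x) i
      · simp [hmix, hi]
  have main : ∀ s : Finset (Fin N), |profileExpectation φ (mix s) - profileExpectation φ x -
      ∑ i ∈ s, ∑ b, (y - x) i b * polyPayoff r i b x| ≤
        s.card * (Fintype.card A * payoffBound r * ‖y - x‖ ^ 2) := by
    intro s
    induction s using Finset.induction_on with
    | empty => simp [hmix]
    | insert i s hi ih =>
      have h1 : mix (insert i s) = Function.update (mix s) i (y i) := by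
        funext j
        by_cases hj : j = i
        · subst hj; simp [hmix]
        · simp [hmix, hj]
      have h2 := MatrixGame.profileExpectation_update_sub hr hφ (fun l => (hmem s l).2) i (hy i).2
      have h3 : mix s i = x i := by simp [hmix, hi]
      rw [← h1, h3] at h2
      have h4 : |∑ b, (y - x) i b * (polyPayoff r i b (mix s) - polyPayoff r i b x)| ≤
          Fintype.card A * payoffBound r * ‖y - x‖ ^ 2 := by
        have h5 : ∀ b, |(y - x) i b * (polyPayoff r i b (mix s) - polyPayoff r i b x)| ≤
            ‖y - x‖ * (payoffBound r * ‖y - x‖) := fun b => by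
          rw [abs_mul]
          refine mul_le_mul ((norm_le_pi_norm ((y - x) i) b).trans (norm_le_pi_norm (y - x) i))
            ((abs_polyPayoff_sub_le r i b _ _).trans ?_) (abs_nonneg _) (norm_nonneg _)
          exact mul_le_mul_of_nonneg_left (hnorm s) (payoffBound_pos r).le
        refine (Finset.abs_sum_le_sum_abs _ _).trans
          ((Finset.sum_le_sum fun b _ => h5 b).trans (le_of_eq ?_))
        simp only [Finset.sum_const, Finset.card_univ, nsmul_eq_mul]
        ring
      have h6 : profileExpectation φ (mix (insert i s)) - profileExpectation φ x -
          ∑ i ∈ insert i s, ∑ b, (y - x) i b * polyPayoff r i b x =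
          (profileExpectation φ (mix s) - profileExpectation φ x -
            ∑ i ∈ s, ∑ b, (y - x) i b * polyPayoff r i b x) +
          ∑ b, (y - x) i b * (polyPayoff r i b (mix s) - polyPayoff r i b x) := by
        rw [Finset.sum_insert hi]
        simp only [mul_sub, Finset.sum_sub_distrib, Pi.sub_apply] at h2 ⊢
        linarith
      rw [h6, Finset.card_insert_of_notMem hi]
      refine (abs_add_le _ _).trans ?_
      push_cast
      linarith
  have h1 := main Finset.univ
  have h2 : mix Finset.univ = y := by funext i; simp [hmix]
  rw [h2, Finset.card_fin] at h1
  exact h1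

/-- Fictitious play in polymatrix potential games. -/
theorem PerturbedFictitiousPlay.tendsto_exploitability_of_potential [Nonempty A]
    {r : Fin N → Fin N → A → A → ℝ} {β η : ℕ → ℝ} {u : ℕ → Fin N → A}
    {x : ℕ → Fin N → A → ℝ} (h : PerturbedFictitiousPlay r β η u x) {G : MatrixGame N A}
    (hr : ∀ i a, G.reward i a = ∑ j ∈ Finset.univ.erase i, r i j (a i) (a j))
    (hG : G.IsPotential) :
    Tendsto (fun k => exploitability r (x k)) atTop (𝓝 0) := by
  obtain ⟨φ, hφ⟩ := hG
  have hL := payoffBound_pos r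
  set C : ℝ := N * (Fintype.card A * payoffBound r) with hC
  -- The potential differences telescope and stay bounded, and the remaining terms are summable.
  have hstep : ∀ k, β k * exploitability r (x k) ≤
      (profileExpectation φ (x (k + 1)) - profileExpectation φ (x k)) +
        (N * (β k * η k) + C * β k ^ 2) := by
    intro k
    have h1 := (abs_le.1
      (MatrixGame.abs_profileExpectation_sub_le hr hφ (h.mem k) (h.mem (k + 1)))).1
    have h2 : totalPayoff r (x (k + 1) - x k) (x k) =
        β k * (totalPayoff r (pureProfile (u k)) (x k) - totalPayoff r (x k) (x k)) := by
      rw [h.step k, add_sub_cancel_left, ← totalPayoff_sub_left]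
      simp only [totalPayoff, Finset.mul_sum, Pi.smul_apply, smul_eq_mul, mul_assoc]
    have h3 := sum_bestPayoff_le_totalPayoff_add r (pureProfile_mem_mixedProfiles (u k))
      (π := x k) (δ := η k) fun i b hb => by
        have : b = u k i := by
          by_contra hne
          simp [pureProfile, hne] at hb
        rw [this]
        exact h.best k i
    have h4 : β k * exploitability r (x k) ≤ β k * (totalPayoff r (pureProfile (u k)) (x k) +
        N * η k - totalPayoff r (x k) (x k)) :=
      mul_le_mul_of_nonneg_left (by unfold exploitability; linarith) (h.step_nonneg k)
    have h5 : (N : ℝ) * (Fintype.card A * payoffBound r * ‖x (k + 1) - x k‖ ^ 2) ≤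
        C * β k ^ 2 := by
      rw [hC, mul_assoc (N : ℝ)]
      gcongr
      exact h.norm_succ_sub_le k
    linarith
  have hsum1 : Summable fun k => N * (β k * η k) + C * β k ^ 2 :=
    (h.error_summable.mul_left _).add (h.sq_summable.mul_left _)
  obtain ⟨B, hB⟩ := hsum1.hasSum.tendsto_sum_nat.bddAbove_range
  have hsum : Summable fun k => β k * exploitability r (x k) := by
    refine summable_of_sum_range_le (c := 2 * (∑ a, |φ a|) + B)
      (fun k => mul_nonneg (h.step_nonneg k) (exploitability_nonneg r (h.mem k))) fun n => ?_
    refine (Finset.sum_le_sum fun k _ => hstep k).trans ?_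
    rw [Finset.sum_add_distrib, Finset.sum_range_sub fun k => profileExpectation φ (x k)]
    have h1 := (abs_le.1 (abs_profileExpectation_le φ (h.mem n))).2
    have h2 := (abs_le.1 (abs_profileExpectation_le φ (h.mem 0))).1
    have h3 := hB (Set.mem_range_self n)
    linarith
  refine tendsto_zero_of_summable_mul h.step_nonneg h.sum_step h.step_tendsto
    (fun k => exploitability_nonneg r (h.mem k)) hsum
    (C := (2 * N + N * Fintype.card A) * payoffBound r) fun k => ?_
  exact (abs_exploitability_sub_le r (h.mem (k + 1)) (h.mem k)).trans
    (mul_le_mul_of_nonneg_left (h.norm_succ_sub_le k) (by positivity))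

end FictitiousPlay

/-! ### Reduction of aggregate fictitious play to perturbed fictitious play. -/

theorem empiricalFreq_succ {N : ℕ} {A : Type*} [DecidableEq A] (α : ℕ → ℝ) (a : ℕ → Fin N → A) (k : ℕ) :
    empiricalFreq α a (k + 1) = empiricalFreq α a k +
      α (k + 1) • (pureProfile (a (k + 1)) - empiricalFreq α a k) := rfl

section AggregateFictitiousPlay

variable {N : ℕ} {A : Type*} [Fintype A] [DecidableEq A]

theorem aggregate_update (i : Fin N) (a : Fin N → A) (b : A) :
    aggregate i (Function.update a i b) = aggregate i a := by
  refine Subtype.ext ?_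
  simp only [aggregate]
  refine Finset.sum_congr rfl fun j hj => ?_
  rw [Function.update_of_ne (Finset.ne_of_mem_erase hj)]

theorem polyPayoff_pureProfile (r : Fin N → Fin N → A → A → ℝ) (i : Fin N) (b : A)
    (a : Fin N → A) :
    polyPayoff r i b (pureProfile a) = ∑ j ∈ Finset.univ.erase i, r i j b (a j) := by
  simp [polyPayoff, pureProfile, Pi.single_apply]

/-- In an anonymous polymatrix game, the payoffs against the aggregate belief are the payoffs
against the empirical action frequencies. -/
theorem MatrixGame.IsAnonymous.aggExpectedReward_aggBelief {G : MatrixGame N A}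
    (hG : G.IsAnonymous) {r : Fin N → Fin N → A → A → ℝ}
    (hr : ∀ i a, G.reward i a = ∑ j ∈ Finset.univ.erase i, r i j (a i) (a j))
    (α : ℕ → ℝ) (a : ℕ → Fin N → A) (i : Fin N) (b : A) (k : ℕ) :
    G.aggExpectedReward i b (aggBelief α a i k) = polyPayoff r i b (empiricalFreq α a k) := by
  -- Replacing the action of player `i` by `b` leaves the aggregate unchanged, so the succinct
  -- reward can be read off the polymatrix form.
  have hpure : ∀ c : Fin N → A, G.aggExpectedReward i b (Pi.single (aggregate i c) 1) =
      polyPayoff r i b (pureProfile c) := by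
    intro c
    have h1 := hG.reward_eq_succinctReward i (Function.update c i b)
    rw [aggregate_update, Function.update_self, hr, Function.update_self] at h1
    rw [polyPayoff_pureProfile]
    have h2 : G.aggExpectedReward i b (Pi.single (aggregate i c) 1) =
        G.succinctReward i b (aggregate i c) := by
      simp [MatrixGame.aggExpectedReward, Pi.single_apply]
    rw [h2, ← h1]
    refine Finset.sum_congr rfl fun j hj => ?_
    rw [Function.update_of_ne (Finset.ne_of_mem_erase hj)]
  -- Both payoffs are linear, and beliefs and frequencies obey the same recursion; nothing is needed
  -- about the size of the steps.
  induction k with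
  | zero => exact hpure (a 0)
  | succ k ih =>
    rw [empiricalFreq_succ, polyPayoff_add, polyPayoff_smul, polyPayoff_sub, ← ih, ← hpure]
    simp only [aggBelief, MatrixGame.aggExpectedReward, Pi.add_apply, Pi.smul_apply,
      Pi.sub_apply, smul_eq_mul, Finset.mul_sum, ← Finset.sum_sub_distrib,
      ← Finset.sum_add_distrib]
    exact Finset.sum_congr rfl fun c _ => by ring

theorem empiricalFreq_mem_mixedProfiles {α : ℕ → ℝ} (h0 : ∀ k, 0 ≤ α (k + 1))
    (h1 : ∀ k, α (k + 1) ≤ 1) (a : ℕ → Fin N → A) (k : ℕ) :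
    empiricalFreq α a k ∈ mixedProfiles N A := by
  induction k with
  | zero => exact pureProfile_mem_mixedProfiles (a 0)
  | succ k ih =>
    rw [empiricalFreq_succ]
    exact convex_mixedProfiles.add_smul_sub_mem ih (pureProfile_mem_mixedProfiles _)
      ⟨h0 k, h1 k⟩

/-- A sequence contracted by the factors `1 - β k` tends to zero. -/
theorem tendsto_zero_of_succ_eq_one_sub_mul {β e : ℕ → ℝ} (hβ : ∀ k, 0 ≤ β k)
    (htop : Tendsto (fun n => ∑ k ∈ Finset.range n, β k) atTop atTop) (he : ∀ k, 0 ≤ e k)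
    (h : ∀ k, e (k + 1) = (1 - β k) * e k) :
    Tendsto e atTop (𝓝 0) ∧ Summable fun k => β k * e k := by
  have hsub : ∀ k, β k * e k = e k - e (k + 1) := fun k => by rw [h]; ring
  have hsum : Summable fun k => β k * e k := by
    refine summable_of_sum_range_le (c := e 0) (fun k => mul_nonneg (hβ k) (he k)) fun n => ?_
    simp_rw [hsub]
    rw [Finset.sum_range_sub']
    linarith [he n]
  refine ⟨?_, hsum⟩
  have hanti : Antitone e := antitone_nat_of_succ_le fun k => by
    linarith [hsub k, mul_nonneg (hβ k) (he k)]
  have hlim := tendsto_atTop_ciInf hanti ⟨0, Set.forall_mem_range.2 he⟩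
  set ℓ := ⨅ k, e k with hℓ
  have hle : ∀ k, ℓ ≤ e k := fun k => ciInf_le ⟨0, Set.forall_mem_range.2 he⟩ k
  have hℓ0 : 0 ≤ ℓ := le_ciInf he
  -- A positive limit would make `β` itself summable.
  rcases hℓ0.eq_or_lt with h0 | h0
  · rwa [← h0] at hlim
  · exfalso
    have h1 : Summable fun k => β k * ℓ :=
      hsum.of_nonneg_of_le (fun k => mul_nonneg (hβ k) hℓ0)
        fun k => mul_le_mul_of_nonneg_left (hle k) (hβ k)
    have h2 : Summable β := (summable_mul_right_iff h0.ne').1 h1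
    exact not_tendsto_nhds_of_tendsto_atTop htop _ h2.hasSum.tendsto_sum_nat

theorem RobbinsMonro.tendsto_sum_shift {α : ℕ → ℝ} (hα : RobbinsMonro α) (K : ℕ) :
    Tendsto (fun n => ∑ k ∈ Finset.range n, α (k + 1 + K)) atTop atTop := by
  have h1 : ∀ n, ∑ k ∈ Finset.Icc 1 n, α k = ∑ k ∈ Finset.range n, α (k + 1) := fun n => by
    rw [Finset.range_eq_Ico, Finset.sum_Ico_add' α 0 n 1]
    rfl
  have h2 := (tendsto_add_atTop_iff_nat K).2 hα.sum_eq_top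
  simp_rw [h1] at h2
  have h3 : ∀ n, ∑ k ∈ Finset.range n, α (k + 1 + K) =
      -(∑ k ∈ Finset.range K, α (k + 1)) + ∑ k ∈ Finset.range (n + K), α (k + 1) := fun n => by
    rw [add_comm n K, Finset.sum_range_add, neg_add_cancel_left]
    exact Finset.sum_congr rfl fun k _ => by congr 1; omega
  simp_rw [h3]
  exact tendsto_atTop_add_const_left _ _ h2

/-- From some time on, aggregate fictitious play is close to a perturbed fictitious play. -/
theorem MatrixGame.IsAggFP.exists_perturbedFictitiousPlay [Nonempty A] {G : MatrixGame N A}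
    {α : ℕ → ℝ} {a : ℕ → Fin N → A} (ha : G.IsAggFP α a) (hG : G.IsAnonymous)
    {r : Fin N → Fin N → A → A → ℝ}
    (hr : ∀ i a, G.reward i a = ∑ j ∈ Finset.univ.erase i, r i j (a i) (a j))
    (hα : RobbinsMonro α) :
    ∃ (K : ℕ) (β η : ℕ → ℝ) (u : ℕ → Fin N → A) (x : ℕ → Fin N → A → ℝ),
      PerturbedFictitiousPlay r β η u x ∧
      Tendsto (fun k => ‖empiricalFreq α a (k + K) - x k‖) atTop (𝓝 0) := by
  have hlim : Tendsto (fun k => α (k + 1)) atTop (𝓝 0) := by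
    have h1 := hα.sq_summable.tendsto_atTop_zero.sqrt
    simpa [Real.sqrt_sq (hα.nonneg _ (Nat.le_add_left 1 _))] using h1
  -- Steps are at most one from here on, and `K ≥ 1` because best responses are only imposed from
  -- stage one.
  obtain ⟨K, hK⟩ := eventually_atTop.1
    ((hlim.eventually_le_const zero_lt_one).and (eventually_ge_atTop 1))
  set α' : ℕ → ℝ := fun k => α (k + K) with hα'
  -- The restarted frequencies begin at the pure profile of `a K` and then use the same actions and
  -- steps as the original ones.
  set x := empiricalFreq α' fun k => a (k + K) with hx
  have hnonneg : ∀ k, 0 ≤ α' (k + 1) := fun k => hα.nonneg _ (by omega)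
  have hle : ∀ k, α' (k + 1) ≤ 1 := fun k => by
    have h1 := (hK (k + K) (by omega)).1
    rwa [add_right_comm] at h1
  set e : ℕ → ℝ := fun k => ‖empiricalFreq α a (k + K) - x k‖ with he
  have hestep : ∀ k, e (k + 1) = (1 - α' (k + 1)) * e k := by
    intro k
    have h1 : empiricalFreq α a (k + 1 + K) - x (k + 1) =
        (1 - α' (k + 1)) • (empiricalFreq α a (k + K) - x k) := by
      have h2 : k + 1 + K = k + K + 1 := by omega
      have h3 : α (k + K + 1) = α' (k + 1) := by simp only [hα', h2]
      rw [hx, empiricalFreq_succ, h2, empiricalFreq_succ, h3]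
      module
    simp only [he, h1, norm_smul, Real.norm_of_nonneg (sub_nonneg.2 (hle k))]
  have htop := hα.tendsto_sum_shift K
  obtain ⟨he0, hesum⟩ := tendsto_zero_of_succ_eq_one_sub_mul (e := e) hnonneg htop
    (fun k => norm_nonneg _) hestep
  -- The action `a (k + 1 + K)` is an exact best response to the original frequencies at `k + K`.
  -- Two payoff comparisons at distance `e k` give the error `2 * payoffBound r * e k`.
  refine ⟨K, fun k => α' (k + 1), fun k => 2 * payoffBound r * e k, fun k => a (k + 1 + K), x,
    ⟨hnonneg, htop, ?_, empiricalFreq_mem_mixedProfiles hnonneg hle _, fun k => rfl, ?_, ?_, ?_⟩,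
    he0⟩
  · refine ((summable_nat_add_iff K).2 hα.sq_summable).congr fun k => ?_
    simp only [hα', add_right_comm]
  · simpa using he0.const_mul (2 * payoffBound r)
  · refine (hesum.mul_left (2 * payoffBound r)).congr fun k => by ring
  · intro k i
    refine bestPayoff_le r fun b => ?_
    have h1 := ha (k + K) ((hK K le_rfl).2.trans (by omega)) i b
    rw [hG.aggExpectedReward_aggBelief hr, hG.aggExpectedReward_aggBelief hr,
      add_right_comm k K 1] at h1
    have h2 := (abs_le.1 (abs_polyPayoff_sub_le r i b (empiricalFreq α a (k + K)) (x k))).1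
    have h3 := (abs_le.1 (abs_polyPayoff_sub_le r i (a (k + 1 + K) i)
      (empiricalFreq α a (k + K)) (x k))).2
    simp only [he]
    linarith

end AggregateFictitiousPlay

/-! ### Convergence to Nash equilibrium. -/

theorem mainTheorem3 {N : ℕ} {A : Type*} [Fintype A] [DecidableEq A] (G : MatrixGame N A)
    (hanon : G.IsAnonymous) (hpoly : G.IsPolymatrix) (hG : G.IsZeroSum ∨ G.IsPotential)
    (α : ℕ → ℝ) (hα : RobbinsMonro α) (a : ℕ → Fin N → A) (ha : G.IsAggFP α a) :
    G.ConvergesToNash α a := by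
  unfold MatrixGame.ConvergesToNash
  -- Without players `A` may be empty, but the empty profile is an equilibrium.
  rcases Nat.eq_zero_or_pos N with rfl | hN
  · have h : ∀ k, Metric.infEDist (empiricalFreq α a k) G.nashEquilibria = 0 := fun k =>
      Metric.infEDist_zero_of_mem ⟨fun i => i.elim0, fun i => i.elim0⟩
    simp only [h, tendsto_const_nhds]
  have : Nonempty A := ⟨a 0 ⟨0, hN⟩⟩
  obtain ⟨r, hr⟩ := hpoly
  obtain ⟨K, β, η, u, x, hfp, hclose⟩ := ha.exists_perturbedFictitiousPlay hanon hr hα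
  have hV : Tendsto (fun k => exploitability r (x k)) atTop (𝓝 0) := by
    rcases hG with hz | hp
    · exact hfp.tendsto_exploitability_of_zeroSum fun π hπ =>
        hz.totalPayoff_self hr fun i => (hπ i).2
    · exact hfp.tendsto_exploitability_of_potential hr hp
  have hnash := MatrixGame.tendsto_infEDist_nashEquilibria hr hfp.mem hV
  refine (tendsto_add_atTop_iff_nat K).1 ?_
  have hedist : Tendsto (fun k => edist (empiricalFreq α a (k + K)) (x k)) atTop (𝓝 0) := by
    simp_rw [edist_dist, dist_eq_norm]
    simpa using ENNReal.tendsto_ofReal hclose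
  refine tendsto_of_tendsto_of_tendsto_of_le_of_le tendsto_const_nhds
    (by simpa using hnash.add hedist) (fun _ => bot_le) fun k => ?_
  exact Metric.infEDist_le_infEDist_add_edist
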